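/- Let $X$ be a compact (connected) Riemann surface and $L\to X$ a holomorphic line bundle. An ($L$-)quadric bundle of type $(n,d)$ is a pair $(V,\gamma)$ where $V$ is a holomorphic vector bundle on $X$ of rank $n$ and degree $d$, and $\gamma$ is a nonzero holomorphic section of $S^2V^*\otimes L$, viewed as a symmetric map $\gamma:V\to V^*\otimes L$. For a subbundle $V'\subseteq V$ let $V'^\perp=\ker(V^*\to V'^*)$. For $\alpha\in\mathbb{R}$, $(V,\gamma)$ is $\alpha$-semistable if $\alpha\le d/n$ and: (1) for every proper holomorphic subbundle $V'\subsetneq V$: (a) if $\gamma(V')\not\subseteq V'^\perp\otimes L$, then $\deg V'\le d+\alpha(\operatorname{rk}V'-n)$; (b) if $\gamma(V')\subseteq V'^\perp\otimes L$, then $\deg V'\le \frac d2+\alpha\left(\operatorname{rk}V'-\frac n2\right)$; (c) if $\gamma(V')=0$, then $\deg V'\le\alpha\operatorname{rk}V'$; (2) for every strict filtration $0\subsetneq V'\subsetneq V''\subsetneq V$ by holomorphic subbundles with $\gamma(V')\subseteq V''^\perp\otimes L$ and $\gamma(V'')\not\subseteq V''^\perp\otimes L$, one has $\deg V'+\deg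 V''\le d+\alpha(\operatorname{rk}V'+\operatorname{rk}V''-n)$. A critical value (for type $(n,d)$) is a real number $\alpha_c\le d/n$ such that $\alpha_c=d/n$, or there are integers $0<n'<n$ and $d'$ with $\alpha_c=\frac{d-d'}{n-n'}$, or $\alpha_c=\frac{d-2d'}{n-2n'}$ (with $2n'\ne n$), or $\alpha_c=\frac{d'}{n'}$, or there are integers $0<n'<n''<n$ and $d',d''$ with $n'+n''\ne n$ and $\alpha_c=\frac{d-d'-d''}{n-n'-n''}$. Let $\alpha_M=d/n$, and let $\alpha_M^-=\frac dn-\epsilon$ where $\epsilon>0$ is small enough that there are no critical values in $[\alpha_M^-,\alpha_M)$. **Proposition.** Let $(V,\gamma)$ be a quadric bundle of type $(n,d)$. All sufficiently small $\epsilon>0$ (depending only on $n$ and $d$) satisfy the above smallness condition, and for every $\epsilon$ satisfying it, if $(V,\gamma)$ is $\alpha_M^-$-semistable, then $V$ is semistable as a vector bundle, i.e. $\frac{\deg V'}{\operatorname{rk}V'}\le\frac{d}{n}$ for every nonzero proper holomorphic subbundle $V'\subsetneq V$. -/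

import Mathlib

open Bundle Filter Module
open scoped Manifold ContDiff Topology

noncomputable section

namespace QuadricBundles

/-! ### Holomorphic subbundles and their degree -/

section Bundles

variable {X : Type*} [TopologicalSpace X] [ChartedSpace ℂ X]
  (F : Type*) [NormedAddCommGroup F] [NormedSpace ℂ F]
  (V : X → Type*) [TopologicalSpace (TotalSpace F V)]
  [∀ x, AddCommGroup (V x)] [∀ x, Module ℂ (V x)] [∀ x, TopologicalSpace (V x)]
  [FiberBundle F V]

/-- `e` is a holomorphic frame, near the point `p`, of the family `W` of subspaces of the fibres
of `V`: on some open neighbourhood of `p` the `e i` are holomorphic sections of `V`, and their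
values at each point `x` form a basis of `W x`. -/
def IsHolomorphicFrameAt {V : X → Type*} [TopologicalSpace (TotalSpace F V)]
    [∀ x, AddCommGroup (V x)] [∀ x, Module ℂ (V x)] [∀ x, TopologicalSpace (V x)]
    [FiberBundle F V] (W : ∀ x, Submodule ℂ (V x)) {r : ℕ} (e : Fin r → ∀ x, V x) (p : X) :
    Prop :=
  ∃ U : Set X, IsOpen U ∧ p ∈ U ∧
    (∀ i, ContMDiffOn 𝓘(ℂ) (𝓘(ℂ).prod 𝓘(ℂ, F)) ω
      (fun x ↦ TotalSpace.mk' F x (e i x)) U) ∧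
    ∀ x ∈ U, LinearIndependent ℂ (fun i ↦ e i x) ∧
      Submodule.span ℂ (Set.range fun i ↦ e i x) = W x

/-- A holomorphic vector subbundle of `V`: a family of subspaces of the fibres which has a
holomorphic frame of length `rank` near every point. The zero subbundle and the whole of `V` are
included. -/
structure HolomorphicSubbundle where
  /-- The fibre over a point. -/
  fiber : ∀ x, Submodule ℂ (V x)
  /-- The rank. -/
  rank : ℕ
  /-- Local holomorphic frames exist. -/
  exists_frame : ∀ p : X, ∃ e : Fin rank → ∀ x, V x, IsHolomorphicFrameAt F fiber e p

namespace HolomorphicSubbundle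

variable {F V}

/-- The tuple `s` is, near `p`, a meromorphic frame of the subbundle `W`, and its determinant
`s 0 ∧ ⋯ ∧ s (r - 1)`, a meromorphic section of `det W`, has order `k` at `p`. That is, in terms
of a local holomorphic frame `e` of `W` the sections `s j` have a matrix `A` of meromorphic
functions, and `det A` has order `k` at `p` (so that it does not vanish identically near `p`). -/
def HasFrameOrderAt (W : HolomorphicSubbundle F V) (s : Fin W.rank → ∀ x, V x) (p : X) (k : ℤ) :
    Prop :=
  ∃ e : Fin W.rank → ∀ x, V x, IsHolomorphicFrameAt F W.fiber e p ∧
    ∃ A : X → Matrix (Fin W.rank) (Fin W.rank) ℂ,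
      (∀ i j, MeromorphicAt (fun z ↦ A ((chartAt ℂ p).symm z) i j) (chartAt ℂ p p)) ∧
      (∀ᶠ x in 𝓝[≠] p, ∀ j, s j x = ∑ i, A x i j • e i x) ∧
      meromorphicOrderAt (fun z ↦ (A ((chartAt ℂ p).symm z)).det) (chartAt ℂ p p) = (k : WithTop ℤ)

/-- `d` is the degree of the divisor of the meromorphic section `s 0 ∧ ⋯ ∧ s (r - 1)` of `det W`
given by some global meromorphic frame `s` of `W`. -/
def HasDegree (W : HolomorphicSubbundle F V) (d : ℤ) : Prop :=
  ∃ (s : Fin W.rank → ∀ x, V x) (D : X →₀ ℤ),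
    (∀ p, W.HasFrameOrderAt s p (D p)) ∧ d = D.sum fun _ k ↦ k

open Classical in
/-- The degree of a holomorphic subbundle (over a compact Riemann surface): the degree of the
divisor of the determinant of any global meromorphic frame. On a compact Riemann surface
such a frame always exists, and the degree does not depend on it. -/
def degree (W : HolomorphicSubbundle F V) : ℤ :=
  if h : ∃ d, W.HasDegree d then h.choose else 0

end HolomorphicSubbundle

/-- `V`, as a holomorphic subbundle of itself. -/
def whole [VectorBundle ℂ F V] [ContMDiffVectorBundle ω F V 𝓘(ℂ)] [FiniteDimensional ℂ F] :
    HolomorphicSubbundle F V where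
  fiber := fun _ ↦ ⊤
  rank := finrank ℂ F
  exists_frame := fun p ↦ by
    have h := (trivializationAt F V p).isLocalFrameOn_localFrame_baseSet 𝓘(ℂ) ω (finBasis ℂ F)
    exact ⟨(trivializationAt F V p).localFrame (finBasis ℂ F), (trivializationAt F V p).baseSet,
      (trivializationAt F V p).open_baseSet, mem_baseSet_trivializationAt F V p,
      fun i ↦ h.contMDiffOn i,
      fun x hx ↦ ⟨h.linearIndependent hx, top_le_iff.mp (h.generating hx)⟩⟩

/-- A holomorphic vector bundle `V` is semistable if `μ(V') ≤ μ(V)` for every nonzero proper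
holomorphic subbundle `V'`, where `μ = degree / rank`. -/
def IsSemistable [VectorBundle ℂ F V] [ContMDiffVectorBundle ω F V 𝓘(ℂ)]
    [FiniteDimensional ℂ F] : Prop :=
  ∀ V' : HolomorphicSubbundle F V, ⊥ < V'.fiber → V'.fiber < ⊤ →
    (V'.degree : ℝ) / V'.rank ≤ ((whole F V).degree : ℝ) / (whole F V).rank

end Bundles

/-! ### Quadric bundles -/

section Quadric

variable {X : Type*} [TopologicalSpace X] [ChartedSpace ℂ X]
  (F : Type*) [NormedAddCommGroup F] [NormedSpace ℂ F]
  (V : X → Type*) [TopologicalSpace (TotalSpace F V)]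
  [∀ x, AddCommGroup (V x)] [∀ x, Module ℂ (V x)] [∀ x, TopologicalSpace (V x)]
  [∀ x, IsTopologicalAddGroup (V x)] [∀ x, ContinuousSMul ℂ (V x)]
  [FiberBundle F V] [VectorBundle ℂ F V]
  (L : X → Type*) [TopologicalSpace (TotalSpace ℂ L)]
  [∀ x, AddCommGroup (L x)] [∀ x, Module ℂ (L x)] [∀ x, TopologicalSpace (L x)]
  [∀ x, IsTopologicalAddGroup (L x)] [∀ x, ContinuousSMul ℂ (L x)]
  [FiberBundle ℂ L] [VectorBundle ℂ ℂ L]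

/-- A nonzero holomorphic section of `S²V* ⊗ L`, for a line bundle `L`: it is given by symmetric
bilinear forms on the fibres of `V` with values in the fibres of `L`, that is, by a section of
`Hom(V, Hom(V, L)) = V* ⊗ V* ⊗ L`. -/
structure QuadricForm where
  /-- The bilinear form on the fibre over a point. -/
  form : ∀ x, V x →L[ℂ] V x →L[ℂ] L x
  symm : ∀ x (v w : V x), form x v w = form x w v
  holomorphic : ContMDiff 𝓘(ℂ) (𝓘(ℂ).prod 𝓘(ℂ, F →L[ℂ] F →L[ℂ] ℂ)) ω
    (fun x ↦ TotalSpace.mk' (F →L[ℂ] F →L[ℂ] ℂ)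
      (E := fun x ↦ V x →L[ℂ] V x →L[ℂ] L x) x (form x))
  ne_zero : ∃ x, form x ≠ 0

variable {F V} in
/-- The fibre at `x` of `V'^⊥ ⊗ L ⊆ V* ⊗ L = Hom(V, L)`, where `V'^⊥` is the kernel of
`V* → V'*`. -/
def perpTensor (V' : HolomorphicSubbundle F V) (x : X) : Submodule ℂ (V x →L[ℂ] L x) where
  carrier := {φ | ∀ w ∈ V'.fiber x, φ w = 0}
  add_mem' := fun ha hb w hw ↦ by simp [ha w hw, hb w hw]
  zero_mem' := fun w _ ↦ by simp
  smul_mem' := fun c φ hφ w hw ↦ by simp [hφ w hw]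

namespace QuadricForm

variable {F V L}

/-- The fibre at `x` of `γ(V') ⊆ V* ⊗ L`. -/
def image (γ : QuadricForm F V L) (V' : HolomorphicSubbundle F V) (x : X) :
    Submodule ℂ (V x →L[ℂ] L x) :=
  (V'.fiber x).map (γ.form x : V x →ₗ[ℂ] V x →L[ℂ] L x)

/-- `γ(V') ⊆ V''^⊥ ⊗ L`. -/
def MapsIntoPerp (γ : QuadricForm F V L) (V' V'' : HolomorphicSubbundle F V) : Prop :=
  ∀ x, γ.image V' x ≤ perpTensor L V'' x

/-- `γ(V') = 0`. -/
def Kills (γ : QuadricForm F V L) (V' : HolomorphicSubbundle F V) : Prop :=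
  ∀ x, γ.image V' x = ⊥

/-- `α`-semistability of the quadric bundle `(V, γ)`. -/
structure IsAlphaSemistable [ContMDiffVectorBundle ω F V 𝓘(ℂ)] [FiniteDimensional ℂ F]
    (γ : QuadricForm F V L) (α : ℝ) : Prop where
  le_slope : α ≤ ((whole F V).degree : ℝ) / (whole F V).rank
  of_not_mapsIntoPerp : ∀ V' : HolomorphicSubbundle F V, V'.fiber < ⊤ → ¬ γ.MapsIntoPerp V' V' →
    (V'.degree : ℝ) ≤ (whole F V).degree + α * ((V'.rank : ℝ) - (whole F V).rank)
  of_mapsIntoPerp : ∀ V' : HolomorphicSubbundle F V, V'.fiber < ⊤ → γ.MapsIntoPerp V' V' →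
    (V'.degree : ℝ) ≤
      ((whole F V).degree : ℝ) / 2 + α * ((V'.rank : ℝ) - ((whole F V).rank : ℝ) / 2)
  of_kills : ∀ V' : HolomorphicSubbundle F V, V'.fiber < ⊤ → γ.Kills V' →
    (V'.degree : ℝ) ≤ α * V'.rank
  of_filtration : ∀ V' V'' : HolomorphicSubbundle F V,
    ⊥ < V'.fiber → V'.fiber < V''.fiber → V''.fiber < ⊤ →
    γ.MapsIntoPerp V' V'' → ¬ γ.MapsIntoPerp V'' V'' →
    (V'.degree : ℝ) + V''.degree ≤
      (whole F V).degree + α * ((V'.rank : ℝ) + V''.rank - (whole F V).rank)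

end QuadricForm

end Quadric

/-- The critical values of the parameter for quadric bundles of type `(n, d)`: the real numbers
`c ≤ d / n` at which equality is numerically possible in one of the inequalities of
`α`-semistability (without being so for every value of the parameter, hence the nonzero
denominators). -/
def IsCriticalValue (n : ℕ) (d : ℤ) (c : ℝ) : Prop :=
  c ≤ (d : ℝ) / n ∧
    (c = (d : ℝ) / n ∨
      (∃ (n' : ℕ) (d' : ℤ), 0 < n' ∧ n' < n ∧
        (c = ((d : ℝ) - d') / ((n : ℝ) - n') ∨
          (2 * n' ≠ n ∧ c = ((d : ℝ) - 2 * d') / ((n : ℝ) - 2 * n')) ∨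
          c = (d' : ℝ) / n')) ∨
      ∃ (n' n'' : ℕ) (d' d'' : ℤ), 0 < n' ∧ n' < n'' ∧ n'' < n ∧ n' + n'' ≠ n ∧
        c = ((d : ℝ) - d' - d'') / ((n : ℝ) - n' - n''))

/-- `ε > 0` is so small that there are no critical values for type `(n, d)` from
`α_M⁻ = d / n - ε` (included) up to `α_M = d / n` (excluded). -/
def IsSmall (n : ℕ) (d : ℤ) (ε : ℝ) : Prop :=
  0 < ε ∧ ∀ c, IsCriticalValue n d c → ¬ ((d : ℝ) / n - ε ≤ c ∧ c < (d : ℝ) / n)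

end QuadricBundles

end

namespace QuadricBundles

/-! The bounds (1a) and (1b) on a subbundle of rank `r` and degree `e` are affine in `α`, and at `α
= d / n` both become `e ≤ r d / n`, the semistability inequality. If a bound holds at `d / n - ε`
but fails at `d / n`, the value of `α` giving equality lies in `[d / n - ε, d / n)` and is critical,
contradicting `IsSmall`. This is `IsSmall.div_le_of_le` for (1a) and `IsSmall.div_le_of_le_half` for
(1b); every `V'` falls under one of the two. Small `ε` exist because critical values below `d / n`
are fractions with denominator at most `n`, so they stay a fixed distance away from `d / n`. -/

/-- A critical value below `d / n` is a fraction with positive denominator at most `n`. -/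
theorem IsCriticalValue.exists_eq_div {n : ℕ} {d : ℤ} {c : ℝ} (hc : IsCriticalValue n d c)
    (hlt : c < (d : ℝ) / n) : ∃ m k : ℤ, 0 < m ∧ m ≤ n ∧ c = (k : ℝ) / m := by
  -- The denominators `n - 2 * n'` and `n - n' - n''` may be negative, so the sign is normalised
  -- once for all cases.
  have key : ∀ m k : ℤ, m ≠ 0 → |m| ≤ n → c = (k : ℝ) / m →
      ∃ m k : ℤ, 0 < m ∧ m ≤ n ∧ c = (k : ℝ) / m := by
    intro m k hm hmn hck
    rcases lt_or_gt_of_ne hm with h | h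
    · refine ⟨-m, -k, by lia, by rwa [abs_of_neg h] at hmn, ?_⟩
      push_cast
      rw [neg_div_neg_eq, hck]
    · exact ⟨m, k, h, by rwa [abs_of_pos h] at hmn, hck⟩
  obtain ⟨-, h | ⟨n', d', h0, h1, h | ⟨hne, h⟩ | h⟩ | ⟨n', n'', d', d'', h0, h1, h2, hne, h⟩⟩ := hc
  · exact absurd h hlt.ne
  · exact key (n - n') (d - d') (by lia) (by rw [abs_le]; lia) (by push_cast; exact h)
  · exact key (n - 2 * n') (d - 2 * d') (by lia) (by rw [abs_le]; lia) (by push_cast; exact h)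
  · exact key n' d' (by lia) (by rw [abs_le]; lia) (by push_cast; exact h)
  · exact key (n - n' - n'') (d - d' - d'') (by lia) (by rw [abs_le]; lia) (by push_cast; exact h)

/-- A critical value below `d / n` lies below it by at least `1 / n ^ 2`. -/
theorem IsCriticalValue.add_one_div_sq_le {n : ℕ} {d : ℤ} {c : ℝ} (hc : IsCriticalValue n d c)
    (hlt : c < (d : ℝ) / n) : c + 1 / (n : ℝ) ^ 2 ≤ (d : ℝ) / n := by
  obtain ⟨m, k, hm, hmn, rfl⟩ := hc.exists_eq_div hlt
  have hm' : (0 : ℝ) < m := by exact_mod_cast hm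
  have hmn' : (m : ℝ) ≤ n := by exact_mod_cast hmn
  have hn' : (0 : ℝ) < n := hm'.trans_le hmn'
  -- A positive integer is at least `1`; divided by `n * m ≤ n ^ 2`, it gives the gap.
  have hint : (1 : ℝ) ≤ d * m - k * n := by
    rw [div_lt_div_iff₀ hm' hn'] at hlt
    have : k * n < d * m := by exact_mod_cast hlt
    have : 1 ≤ d * m - k * n := by lia
    exact_mod_cast this
  have h1 : 1 / (n : ℝ) ^ 2 ≤ 1 / (n * m) :=
    one_div_le_one_div_of_le (by positivity) (by rw [sq]; gcongr)
  have h2 : 1 / ((n : ℝ) * m) ≤ (d * m - k * n) / (n * m) := by gcongr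
  have h3 : ((d : ℝ) * m - k * n) / (n * m) = d / n - k / m := by field_simp
  linarith

/-- All sufficiently small `ε` satisfy the smallness condition. -/
theorem exists_forall_isSmall (n : ℕ) (d : ℤ) :
    ∃ ε₀ : ℝ, 0 < ε₀ ∧ ∀ ε : ℝ, 0 < ε → ε < ε₀ → IsSmall n d ε := by
  rcases Nat.eq_zero_or_pos n with rfl | hn
  -- For `n = 0` there is no denominator with `0 < m ≤ n`, so any `ε₀` works.
  · refine ⟨1, one_pos, fun ε hε _ ↦ ⟨hε, fun c hc ⟨_, hlt⟩ ↦ ?_⟩⟩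
    obtain ⟨m, k, hm, hm0, -⟩ := hc.exists_eq_div hlt
    lia
  · refine ⟨1 / (n : ℝ) ^ 2, by positivity, fun ε hε hlt ↦ ⟨hε, fun c hc ⟨hle, hc'⟩ ↦ ?_⟩⟩
    linarith [hc.add_one_div_sq_le hc']

section Rank

variable {X : Type*} [TopologicalSpace X] [ChartedSpace ℂ X]
  {F : Type*} [NormedAddCommGroup F] [NormedSpace ℂ F]
  {V : X → Type*} [TopologicalSpace (TotalSpace F V)]
  [∀ x, AddCommGroup (V x)] [∀ x, Module ℂ (V x)] [∀ x, TopologicalSpace (V x)]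
  [FiberBundle F V]

namespace HolomorphicSubbundle

theorem finrank_fiber (W : HolomorphicSubbundle F V) (x : X) :
    finrank ℂ (W.fiber x) = W.rank := by
  obtain ⟨e, U, -, hx, -, h⟩ := W.exists_frame x
  rw [← (h x hx).2, finrank_span_eq_card (h x hx).1, Fintype.card_fin]

/-- Needed because `finrank` detects zero or strictly smaller subspaces only in finite dimension. -/
theorem finite_fiber (W : HolomorphicSubbundle F V) (x : X) :
    FiniteDimensional ℂ (W.fiber x) := by
  obtain ⟨e, U, -, hx, -, h⟩ := W.exists_frame x
  rw [← (h x hx).2]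
  exact FiniteDimensional.span_of_finite ℂ (Set.finite_range _)

theorem rank_pos {W : HolomorphicSubbundle F V} (hW : ⊥ < W.fiber) : 0 < W.rank := by
  refine Nat.pos_of_ne_zero fun h0 ↦ hW.ne' (funext fun x ↦ ?_)
  have := W.finite_fiber x
  exact Submodule.finrank_eq_zero.mp ((W.finrank_fiber x).trans h0)

theorem rank_lt_of_fiber_lt {W W' : HolomorphicSubbundle F V} (h : W.fiber < W'.fiber) :
    W.rank < W'.rank := by
  obtain ⟨hle, x, hx⟩ := Pi.lt_def.mp h
  have := W'.finite_fiber x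
  rw [← W.finrank_fiber x, ← W'.finrank_fiber x]
  exact Submodule.finrank_lt_finrank_of_lt hx

end HolomorphicSubbundle

end Rank

/-- If `ε` is small, an inequality `e ≤ d + α (r - n)` at `α = d / n - ε` implies `e ≤ d r / n`. -/
theorem IsSmall.div_le_of_le {n r : ℕ} {d e : ℤ} {ε : ℝ} (hε : IsSmall n d ε)
    (hr : 0 < r) (hrn : r < n) (h : (e : ℝ) ≤ d + ((d : ℝ) / n - ε) * ((r : ℝ) - n)) :
    (e : ℝ) / r ≤ (d : ℝ) / n := by
  by_contra! hlt
  have hr' : (0 : ℝ) < r := by exact_mod_cast hr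
  have hrn' : (0 : ℝ) < (n : ℝ) - r := sub_pos.mpr (by exact_mod_cast hrn)
  have hdn : (d : ℝ) = d / n * n := (div_mul_cancel₀ _ (by linarith)).symm
  have hlt' : (d : ℝ) / n * r < e := (lt_div_iff₀ hr').mp hlt
  -- The left side is the `α` at which (1a) is an equality.
  have hc : ((d : ℝ) - e) / ((n : ℝ) - r) < d / n := by
    rw [div_lt_iff₀ hrn']
    linarith
  refine hε.2 _ ⟨hc.le, .inr (.inl ⟨r, e, hr, hrn, .inl rfl⟩)⟩ ⟨?_, hc⟩
  rw [le_div_iff₀ hrn']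
  linarith

/-- If `ε` is small, an inequality `e ≤ d / 2 + α (r - n / 2)` at `α = d / n - ε` implies
`e ≤ d r / n`. -/
theorem IsSmall.div_le_of_le_half {n r : ℕ} {d e : ℤ} {ε : ℝ} (hε : IsSmall n d ε)
    (hr : 0 < r) (hrn : r < n)
    (h : (e : ℝ) ≤ (d : ℝ) / 2 + ((d : ℝ) / n - ε) * ((r : ℝ) - (n : ℝ) / 2)) :
    (e : ℝ) / r ≤ (d : ℝ) / n := by
  by_contra! hlt
  have hr' : (0 : ℝ) < r := by exact_mod_cast hr
  have hrn' : (r : ℝ) < n := by exact_mod_cast hrn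
  have hdn : (d : ℝ) = d / n * n := (div_mul_cancel₀ _ (by linarith)).symm
  have hlt' : (d : ℝ) / n * r < e := (lt_div_iff₀ hr').mp hlt
  -- The bound at `d / n - ε` reads `e ≤ r d / n + ε (n / 2 - r)`, so a violation of the slope
  -- inequality forces `2 r < n`.
  have hneg : 0 < ε * ((n : ℝ) - 2 * r) := by linarith
  have hpos : 0 < (n : ℝ) - 2 * r := pos_of_mul_pos_right hneg hε.1.le
  have hne : 2 * r ≠ n := fun h2 ↦ by
    rw [← h2] at hpos
    push_cast at hpos
    linarith
  have hc : ((d : ℝ) - 2 * e) / ((n : ℝ) - 2 * r) < d / n := by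
    rw [div_lt_iff₀ hpos]
    linarith
  refine hε.2 _ ⟨hc.le, .inr (.inl ⟨r, e, hr, hrn, .inr (.inl ⟨hne, rfl⟩)⟩)⟩ ⟨?_, hc⟩
  rw [le_div_iff₀ hpos]
  linarith

end QuadricBundles

theorem mainTheorem6
    {X : Type*} [TopologicalSpace X] [T2Space X] [CompactSpace X] [ConnectedSpace X]
    [ChartedSpace ℂ X] [IsManifold 𝓘(ℂ) ω X]
    {F : Type*} [NormedAddCommGroup F] [NormedSpace ℂ F] [FiniteDimensional ℂ F]
    {V : X → Type*} [TopologicalSpace (TotalSpace F V)]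
    [∀ x, AddCommGroup (V x)] [∀ x, Module ℂ (V x)] [∀ x, TopologicalSpace (V x)]
    [∀ x, IsTopologicalAddGroup (V x)] [∀ x, ContinuousSMul ℂ (V x)]
    [FiberBundle F V] [VectorBundle ℂ F V] [ContMDiffVectorBundle ω F V 𝓘(ℂ)]
    {L : X → Type*} [TopologicalSpace (TotalSpace ℂ L)]
    [∀ x, AddCommGroup (L x)] [∀ x, Module ℂ (L x)] [∀ x, TopologicalSpace (L x)]
    [∀ x, IsTopologicalAddGroup (L x)] [∀ x, ContinuousSMul ℂ (L x)]
    [FiberBundle ℂ L] [VectorBundle ℂ ℂ L] [ContMDiffVectorBundle ω ℂ L 𝓘(ℂ)]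
    (γ : QuadricBundles.QuadricForm F V L) (n : ℕ) (d : ℤ)
    (hn : (QuadricBundles.whole F V).rank = n) (hd : (QuadricBundles.whole F V).degree = d) :
    (∃ ε₀ : ℝ, 0 < ε₀ ∧ ∀ ε : ℝ, 0 < ε → ε < ε₀ → QuadricBundles.IsSmall n d ε) ∧
      ∀ ε : ℝ, QuadricBundles.IsSmall n d ε →
        γ.IsAlphaSemistable ((d : ℝ) / n - ε) → QuadricBundles.IsSemistable F V := by
  refine ⟨QuadricBundles.exists_forall_isSmall n d, fun ε hε hγ V' hbot htop ↦ ?_⟩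
  have hr := QuadricBundles.HolomorphicSubbundle.rank_pos hbot
  -- The fibre of `whole F V` is `⊤` by definition, so `htop` compares two subbundles.
  have hrn : V'.rank < n := hn ▸ QuadricBundles.HolomorphicSubbundle.rank_lt_of_fiber_lt
    (W' := QuadricBundles.whole F V) htop
  rw [hn, hd]
  by_cases hperp : γ.MapsIntoPerp V' V'
  · have h := hγ.of_mapsIntoPerp V' htop hperp
    rw [hn, hd] at h
    exact hε.div_le_of_le_half hr hrn h
  · have h := hγ.of_not_mapsIntoPerp V' htop hperp
    rw [hn, hd] at h
    exact hε.div_le_of_le hr hrn h
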